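/- **Conventions.** A hyperbolic space is a geodesic metric space $X$ (not assumed proper) such that for some $\delta\ge 0$ the Gromov product $(x|y)_w=\tfrac12\big(d(x,w)+d(y,w)-d(x,y)\big)$ satisfies $(x|z)_w\ge\min\{(x|y)_w,(y|z)_w\}-\delta$ for all $w,x,y,z\in X$. Its Gromov boundary $\partial X$ is the set of classes of sequences $(x_n)$ in $X$ with $(x_m|x_n)_w\to\infty$ as $m,n\to\infty$, where $(x_n)\sim(y_n)$ if $(x_m|y_n)_w\to\infty$; we say $(x_n)$ tends to its class. If a group $G$ acts on $X$ by isometries, it acts on $\partial X$, and its limit set is the set of points of $\partial X$ to which some sequence of points in a $G$-orbit tends. The action is of type $(3)^-$ if the limit set consists of exactly two points and these are not both fixed by $G$. The orientation preserving subgroup $G^+$ is then the subgroup of elements fixing both limit points. A quasi-morphism on a group $H$ is a function $f:H\to\mathbb R$ with $|f(gh)-f(g)-f(h)|\le D$ for some $D$ and all $g,h\in H$; it is homogeneous if $f(g^n)=nf(g)$ for all $g\in H$, $n\in\mathbb Z$. Given a sequence ${\bf x}=(x_n)_{n\ge0}$ tending to a limit point $\zeta$, put $\eta_{\bf x}(z)=\liminf_{n\to\infty}\big(d(x_n,x_0)-d(x_n,z)\big)$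 and $f_{\bf x}(g)=\eta_{\bf x}(gx_0)$ for $g\in G^+$. The Busemann quasi-morphism $B:G^+\to\mathbb R$ at $\zeta$ is the homogenisation $B(g)=\lim_{n\to\infty} f_{\bf x}(g^n)/n$ of $f_{\bf x}$. A map $q:Y\to Z$ of metric spaces is a quasi-isometric embedding if $\tfrac1K d(x,y)-\epsilon\le d(q(x),q(y))\le Kd(x,y)+\epsilon$ for some $K\ge1$, $\epsilon\ge0$ and all $x,y$; it is a quasi-isometry if moreover its image is coarse dense, i.e. non-empty and with every point of $Z$ within a fixed distance of it. A quasi-action of $G$ on $Y$ is a map $\alpha:G\times Y\to Y$ such that, for some constants $K\ge 1$ and $\epsilon,C\ge0$, every $\alpha(g,\cdot)$ is a quasi-isometry with constants $(K,\epsilon,C)$ (the last one for coarse density of the image), $d(\alpha(1,y),y)\le C$ and $d(\alpha(g,\alpha(h,y)),\alpha(gh,y))\le C$ for all $g,h,y$. It is cobounded if some $\{\alpha(g,y_0):g\in G\}$ is coarse dense. A quasi-action $\alpha$ of $G$ on $Z$ reduces to a quasi-action $\beta$ of $G$ on $Y$ via $F:Y\to Z$ if $F$ is a quasi-isometric embedding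 and $d\big(F(\beta(g,y)),\alpha(g,F(y))\big)$ is bounded over all $g\in G$, $y\in Y$; the reduction is an equivalence if $F$ is a quasi-isometry. A quasi-line is a geodesic metric space quasi-isometric to $\mathbb R$. **Statement.** Let $G$ be any group with an isometric action of type $(3)^-$ on an arbitrary hyperbolic space $X$, let $G^+$ be its orientation preserving subgroup, and let $B:G^+\to\mathbb R$ be the Busemann quasi-morphism at either one of the two limit points $\zeta$. Then: 1. $G^+$ has index $2$ in $G$. The function $B$ is a homogeneous quasi-morphism on $G^+$, and it is within bounded distance of $f_{\bf x}$ for every sequence ${\bf x}$ tending to $\zeta$ (so it does not depend on the sequence). It is antisymmetric in $G$: $B(tht^{-1})=-B(h)$ for all $t\in G\setminus G^+$ and $h\in G^+$. 2. For every $t\in G\setminus G^+$, the dihedral map $\beta:G\times\mathbb R\to\mathbb R$ given by $\beta(h,x)=x+B(h)$ and $\beta(th,x)=-x-B(h)$ for $h\in G^+$, $x\in\mathbb R$, is a quasi-action of $G$ on $\mathbb R$. 3. The isometric action of $G$ on $X$ reduces to $\beta$: there is a map $F:\mathbb R\to X$ via which it reduces to $\beta$, and, if the isometric action is cobounded, this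 reduction is an equivalence. 4. The isometric action is cobounded if and only if $X$ is a quasi-line. -/

import Mathlib

open Filter Topology

/-! ### Coarse geometry -/

/-- `S` is `C`-coarse dense in `X`. -/
def IsCoarseDenseWith {X : Type*} [MetricSpace X] (C : ℝ) (S : Set X) : Prop :=
  S.Nonempty ∧ ∀ x : X, ∃ s ∈ S, dist x s ≤ C

/-- `S` is coarse dense in `X`. -/
def IsCoarseDense {X : Type*} [MetricSpace X] (S : Set X) : Prop :=
  ∃ C : ℝ, 0 < C ∧ IsCoarseDenseWith C S

/-- `(K, ε)` quasi-isometric embeddings. -/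
structure IsQIEmbeddingWith {X Y : Type*} [MetricSpace X] [MetricSpace Y]
    (K ε : ℝ) (q : X → Y) : Prop where
  one_le : 1 ≤ K
  nonneg : 0 ≤ ε
  lower : ∀ x y : X, (1 / K) * dist x y - ε ≤ dist (q x) (q y)
  upper : ∀ x y : X, dist (q x) (q y) ≤ K * dist x y + ε

/-- `(K, ε, C)` quasi-isometries. -/
structure IsQuasiIsometryWith {X Y : Type*} [MetricSpace X] [MetricSpace Y]
    (K ε C : ℝ) (q : X → Y) : Prop where
  embedding : IsQIEmbeddingWith K ε q
  nonneg : 0 ≤ C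
  coarse_onto : IsCoarseDenseWith C (Set.range q)

/-- Quasi-isometric embeddings. -/
def IsQIEmbedding {X Y : Type*} [MetricSpace X] [MetricSpace Y] (q : X → Y) : Prop :=
  ∃ K ε : ℝ, IsQIEmbeddingWith K ε q

/-- Quasi-isometries. -/
def IsQuasiIsometry {X Y : Type*} [MetricSpace X] [MetricSpace Y] (q : X → Y) : Prop :=
  ∃ K ε C : ℝ, IsQuasiIsometryWith K ε C q

/-- Any two points are joined by an isometrically embedded closed interval. -/
def IsGeodesicSpace (X : Type*) [MetricSpace X] : Prop :=
  ∀ x y : X, ∃ γ : ℝ → X, γ 0 = x ∧ γ (dist x y) = y ∧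
    ∀ s ∈ Set.Icc 0 (dist x y), ∀ t ∈ Set.Icc 0 (dist x y), dist (γ s) (γ t) = |s - t|

/-- A quasi-line: a geodesic metric space which is quasi-isometric to `ℝ`. -/
def IsQuasiLine (X : Type*) [MetricSpace X] : Prop :=
  IsGeodesicSpace X ∧ ∃ f : X → ℝ, IsQuasiIsometry f

/-! ### Quasi-actions -/

/-- `(K, ε, C)` quasi-actions of a group `G` on a metric space `X`. -/
structure IsQuasiActionWith {G X : Type*} [Group G] [MetricSpace X]
    (K ε C : ℝ) (α : G → X → X) : Prop where
  quasiIsometry : ∀ g : G, IsQuasiIsometryWith K ε C (α g)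
  one : ∀ x : X, dist (α 1 x) x ≤ C
  mul : ∀ (x : X) (g h : G), dist (α g (α h x)) (α (g * h) x) ≤ C

/-- Quasi-actions. -/
def IsQuasiAction {G X : Type*} [Group G] [MetricSpace X] (α : G → X → X) : Prop :=
  ∃ K ε C : ℝ, IsQuasiActionWith K ε C α

/-- Some quasi-orbit is coarse dense. -/
def IsCoboundedAction {G X : Type*} [MetricSpace X] (α : G → X → X) : Prop :=
  ∃ x₀ : X, IsCoarseDense (Set.range fun g : G => α g x₀)

/-- `F` is coarse `G`-equivariant from `α` on `X` to `β` on `Y`. -/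
def IsCoarseEquivariant {G X Y : Type*} [MetricSpace Y]
    (α : G → X → X) (β : G → Y → Y) (F : X → Y) : Prop :=
  ∃ M : ℝ, 0 ≤ M ∧ ∀ (x : X) (g : G), dist (F (α g x)) (β g (F x)) ≤ M

/-- `F : X → Y` realises a reduction of `β` (on `Y`) to `α` (on `X`): it is a coarse
`G`-equivariant quasi-isometric embedding from `α` to `β`. -/
def IsReductionMap {G X Y : Type*} [MetricSpace X] [MetricSpace Y]
    (β : G → Y → Y) (α : G → X → X) (F : X → Y) : Prop :=
  IsQIEmbedding F ∧ IsCoarseEquivariant α β F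

/-- `F : X → Y` realises an equivalence between `β` (on `Y`) and `α` (on `X`): it is a coarse
`G`-equivariant quasi-isometry. -/
def IsEquivalenceMap {G X Y : Type*} [MetricSpace X] [MetricSpace Y]
    (β : G → Y → Y) (α : G → X → X) (F : X → Y) : Prop :=
  IsQuasiIsometry F ∧ IsCoarseEquivariant α β F

/-! ### Hyperbolic spaces and the Gromov boundary -/

/-- The Gromov product `(x|y)_w`. -/
noncomputable def gromovProduct {X : Type*} [MetricSpace X] (w x y : X) : ℝ :=
  (dist x w + dist y w - dist x y) / 2

/-- Hyperbolic spaces: geodesic metric spaces satisfying Gromov's four point condition for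
some `δ`. No properness is assumed. -/
class IsHyperbolicSpace (X : Type*) [MetricSpace X] : Prop where
  geodesic : IsGeodesicSpace X
  hyperbolic : ∃ δ : ℝ, 0 ≤ δ ∧ ∀ w x y z : X,
    min (gromovProduct w x y) (gromovProduct w y z) - δ ≤ gromovProduct w x z

/-- `(x_m|y_n)_w → ∞` as `m, n → ∞` (for every base point `w`, equivalently for one). -/
def GromovClose {X : Type*} [MetricSpace X] (x y : ℕ → X) : Prop :=
  ∀ w : X, Tendsto (fun p : ℕ × ℕ => gromovProduct w (x p.1) (y p.2)) atTop atTop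

/-- The sequences converging to infinity, that is with `(x_m|x_n)_w → ∞`. -/
def GromovSeq (X : Type*) [MetricSpace X] : Type _ :=
  {x : ℕ → X // GromovClose x x}

/-- Equivalence of sequences converging to infinity. -/
instance gromovSetoid (X : Type*) [MetricSpace X] [IsHyperbolicSpace X] :
    Setoid (GromovSeq X) where
  r x y := GromovClose x.1 y.1
  iseqv :=
    { refl := fun x => x.2
      symm := by
        intro x y h w
        have h1 := (h w).comp (show Tendsto (Prod.swap : ℕ × ℕ → ℕ × ℕ) atTop atTop by
          rw [← prod_atTop_atTop_eq]
          exact tendsto_snd.prodMk tendsto_fst)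
        refine h1.congr fun p => ?_
        simp only [Function.comp, Prod.fst_swap, Prod.snd_swap, gromovProduct]
        rw [dist_comm (x.1 p.2) (y.1 p.1)]
        ring
      trans := by
        intro x y z hxy hyz w
        obtain ⟨δ, -, hδ⟩ := IsHyperbolicSpace.hyperbolic (X := X)
        have h1 : Tendsto (fun p : ℕ × ℕ => gromovProduct w (x.1 p.1) (y.1 p.1)) atTop atTop :=
          (hxy w).comp (show Tendsto (fun p : ℕ × ℕ => (p.1, p.1)) atTop atTop by
            rw [← prod_atTop_atTop_eq]
            exact tendsto_fst.prodMk tendsto_fst)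
        rw [tendsto_atTop] at *
        intro b
        filter_upwards [h1 (b + δ), (tendsto_atTop.1 (hyz w)) (b + δ)] with p hp hq
        have := hδ w (x.1 p.1) (y.1 p.1) (z.1 p.2)
        have := le_min hp hq
        linarith }

/-- The Gromov boundary `∂X`. -/
def GromovBoundary (X : Type*) [MetricSpace X] [IsHyperbolicSpace X] : Type _ :=
  Quotient (gromovSetoid X)

/-- The boundary point represented by a sequence converging to infinity. -/
def GromovBoundary.mk {X : Type*} [MetricSpace X] [IsHyperbolicSpace X] (x : GromovSeq X) :
    GromovBoundary X :=
  Quotient.mk (gromovSetoid X) x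

theorem GromovClose.smul {G X : Type*} [Group G] [MetricSpace X] [MulAction G X]
    [IsIsometricSMul G X] (g : G) {x y : ℕ → X} (h : GromovClose x y) :
    GromovClose (fun n => g • x n) (fun n => g • y n) := by
  intro w
  refine (h (g⁻¹ • w)).congr fun p => ?_
  have h1 : ∀ a : X, dist (g • a) w = dist a (g⁻¹ • w) := fun a => by
    rw [← dist_smul g a (g⁻¹ • w), smul_inv_smul]
  simp only [gromovProduct, h1, dist_smul]

/-- The translate of a sequence converging to infinity by a group element. -/
def GromovSeq.translate {G X : Type*} [Group G] [MetricSpace X] [MulAction G X]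
    [IsIsometricSMul G X] (g : G) (x : GromovSeq X) : GromovSeq X :=
  ⟨fun n => g • x.1 n, x.2.smul g⟩

/-- The action on the Gromov boundary induced by an isometric action. -/
instance gromovBoundaryAction (G X : Type*) [Group G] [MetricSpace X] [IsHyperbolicSpace X]
    [MulAction G X] [IsIsometricSMul G X] : MulAction G (GromovBoundary X) where
  smul g := Quotient.map (GromovSeq.translate g) fun _ _ h => GromovClose.smul g h
  one_smul := by
    rintro ⟨x⟩
    exact congrArg (Quotient.mk _) (Subtype.ext (funext fun n => one_smul G (x.1 n)))
  mul_smul := by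
    rintro g h ⟨x⟩
    exact congrArg (Quotient.mk _) (Subtype.ext (funext fun n => mul_smul g h (x.1 n)))

/-- The limit set `∂_G X`: the boundary points that are limits of a sequence of points of an
orbit. -/
def limitSet (G X : Type*) [Group G] [MetricSpace X] [IsHyperbolicSpace X] [MulAction G X] :
    Set (GromovBoundary X) :=
  {ζ | ∃ (x₀ : X) (g : ℕ → G) (h : GromovClose (fun n => g n • x₀) (fun n => g n • x₀)),
    ζ = GromovBoundary.mk ⟨fun n => g n • x₀, h⟩}

/-- The orientation preserving subgroup `G⁺`: the elements fixing every limit point. -/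
def orientationPreserving (G X : Type*) [Group G] [MetricSpace X] [IsHyperbolicSpace X]
    [MulAction G X] [IsIsometricSMul G X] : Subgroup G :=
  fixingSubgroup G (limitSet G X)

/-- Actions of type (3)⁻: the limit set consists of exactly two points, and they are not both
fixed by `G`. -/
def IsTypeThreeMinus (G X : Type*) [Group G] [MetricSpace X] [IsHyperbolicSpace X]
    [MulAction G X] [IsIsometricSMul G X] : Prop :=
  (limitSet G X).encard = 2 ∧ ∃ g : G, ∃ ζ ∈ limitSet G X, g • ζ ≠ ζ

/-! ### Quasi-morphisms and the Busemann quasi-morphism -/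

/-- Real valued quasi-morphisms. -/
def IsQuasimorphism {H : Type*} [Group H] (f : H → ℝ) : Prop :=
  ∃ D : ℝ, 0 ≤ D ∧ ∀ g h : H, |f (g * h) - f g - f h| ≤ D

/-- Homogeneous quasi-morphisms. -/
def IsHomogeneousQuasimorphism {H : Type*} [Group H] (f : H → ℝ) : Prop :=
  IsQuasimorphism f ∧ ∀ (g : H) (n : ℤ), f (g ^ n) = n * f g

/-- The homogenisation `g ↦ lim f (g ^ n) / n` of a quasi-morphism `f`. -/
noncomputable def homogenisation {H : Type*} [Group H] (f : H → ℝ) (g : H) : ℝ :=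
  limUnder atTop fun n : ℕ => f (g ^ n) / n

/-- The quasi-horofunction `η(z) = liminf (d(x_n, x_0) - d(x_n, z))` of a sequence. -/
noncomputable def quasiHorofunction {X : Type*} [MetricSpace X] (x : ℕ → X) (z : X) : ℝ :=
  liminf (fun n : ℕ => dist (x n) (x 0) - dist (x n) z) atTop

/-- The function `g ↦ η(g x_0)` on a group acting on `X`. -/
noncomputable def horoQuasimorphism (H : Type*) {X : Type*} [Group H] [MetricSpace X]
    [MulAction H X] (x : ℕ → X) (g : H) : ℝ :=
  quasiHorofunction x (g • x 0)

/-- The Busemann quasi-morphism at a boundary point `ζ` of a group `H` acting by isometries and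
fixing `ζ`, formed with a chosen sequence tending to `ζ`. -/
noncomputable def busemann (H : Type*) {X : Type*} [Group H] [MetricSpace X]
    [IsHyperbolicSpace X] [MulAction H X] (ζ : GromovBoundary X) : H → ℝ :=
  homogenisation (horoQuasimorphism H (Quotient.out ζ).1)

/-! ### Dihedral quasi-actions -/

/-- For `H` of index 2 in `G`, a function `q` on `H` is antisymmetric in `G` if
`q (t h t⁻¹) = - q h` for all `t ∈ G \ H` and `h ∈ H`. -/
def IsAntisymmetricIn {G : Type*} [Group G] (H : Subgroup G) (hH : H.index = 2)
    (q : H → ℝ) : Prop :=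
  ∀ t : G, t ∉ H → ∀ h : H,
    q ⟨t * h * t⁻¹, (Subgroup.normal_of_index_eq_two hH).conj_mem h h.2 t⟩ = -q h

open Classical in
/-- The dihedral quasi-action of `G` on `ℝ` by `q : H → ℝ`, for `H` of index 2 in `G` and
`t ∈ G \ H`: `h` acts as `x ↦ x + q h` and `t h` acts as `x ↦ -x - q h`, for `h ∈ H`. -/
noncomputable def dihedralQuasiAction {G : Type*} [Group G] (H : Subgroup G) (hH : H.index = 2)
    (q : H → ℝ) (t : G) (ht : t ∉ H) (g : G) (x : ℝ) : ℝ :=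
  if hg : g ∈ H then x + q ⟨g, hg⟩
  else -x - q ⟨t⁻¹ * g, (Subgroup.mul_mem_iff_of_index_two hH).2
    (iff_of_false (fun h => ht (inv_mem_iff.1 h)) hg)⟩

/-! ### Quasi-morphisms and their homogenisations -/

/-! Distance differences to a sequence tending to `ζ` are determined by `ζ` up to `2δ` in the far
range. Hence `g ↦ η(g x₀)` is a quasi-morphism of defect `6δ` on the stabiliser of `ζ`, which is
`G⁺`, and its homogenisation `B` stays within `6δ` of it.

An element `t` outside `G⁺` exchanges the two limit points, so `t⁻¹ xₙ` tends to the other one.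
Since `G⁺` fixes both ends, the Gromov product of `xₙ` and `t⁻¹ xₙ` seen from `h x₀` is eventually
bounded, by a constant independent of `h ∈ G⁺`: the orbit runs along a coarse line joining the ends
(`exists_forall_eventually_gromovProduct_smul_le`). Two things follow. The displacement `d(x₀, h
x₀)` is `|B h|` up to a constant. The horofunctions at the two ends are opposite along the orbit, so
`B(tht⁻¹) + B(h)` is bounded, hence zero after passing to powers of `h`.

Orbits are unbounded, so `B a ≠ 0` for some `a`, and the powers of `a` applied to `x₀` give the
reduction map from `ℝ`. If the action is cobounded, equivariance makes this map coarsely onto.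
Conversely, if `X` is a quasi-line, the map becomes a quasi-isometric embedding of `ℝ` into itself,
which is automatically coarsely onto, so an orbit is coarse dense. -/

theorem eq_zero_of_forall_natCast_mul_le {c C : ℝ} (h : ∀ n : ℕ, |n * c| ≤ C) : c = 0 := by
  by_contra hc
  obtain ⟨n, hn⟩ := exists_nat_gt (C / |c|)
  have hc' : 0 < |c| := abs_pos.2 hc
  have h1 := h n
  rw [abs_mul, Nat.abs_cast] at h1
  rw [div_lt_iff₀ hc'] at hn
  linarith

theorem abs_pow_sub_nsmul_le {H : Type*} [Group H] {f : H → ℝ} {D : ℝ}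
    (hf : ∀ g h : H, |f (g * h) - f g - f h| ≤ D) (g : H) (n : ℕ) :
    |f (g ^ (n + 1)) - (n + 1) * f g| ≤ n * D := by
  induction n with
  | zero => simp
  | succ n ih =>
    have h1 := hf (g ^ (n + 1)) g
    rw [← pow_succ] at h1
    rw [abs_le] at *
    push_cast
    constructor <;> linarith [h1.1, h1.2, ih.1, ih.2]

/-- Fekete's lemma: adding the defect `D` makes `n ↦ f (g ^ n)` subadditive, and `D / n` vanishes in
the limit. -/
theorem tendsto_homogenisation {H : Type*} [Group H] {f : H → ℝ} {D : ℝ}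
    (hf : ∀ g h : H, |f (g * h) - f g - f h| ≤ D) (g : H) :
    Tendsto (fun n : ℕ => f (g ^ n) / n) atTop (𝓝 (homogenisation f g)) := by
  have hsub : Subadditive fun n : ℕ => f (g ^ n) + D := by
    intro m n
    have := hf (g ^ m) (g ^ n)
    rw [← pow_add] at this
    linarith [(abs_le.1 this).2]
  have hD : 0 ≤ D := (abs_nonneg _).trans (hf 1 1)
  have hbdd : BddBelow (Set.range fun n : ℕ => (f (g ^ n) + D) / n) := by
    refine ⟨-(|f g| + D), ?_⟩
    rintro _ ⟨n, rfl⟩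
    -- The index `0` belongs to the range too; its quotient is `0` by the convention for division by
    -- zero.
    rcases n with _ | n
    · simp only [Nat.cast_zero, div_zero]
      linarith [abs_nonneg (f g)]
    · have h1 := (abs_le.1 (abs_pow_sub_nsmul_le hf g n)).1
      have hn : (0 : ℝ) ≤ n := n.cast_nonneg
      have h2 : -|f g| * (n + 1) ≤ f g * (n + 1) :=
        mul_le_mul_of_nonneg_right (neg_abs_le _) (by positivity)
      simp only
      rw [le_div_iff₀ (by positivity)]
      push_cast
      linarith
  have h1 := hsub.tendsto_lim hbdd
  have h2 : Tendsto (fun n : ℕ => D / (n : ℝ)) atTop (𝓝 0) :=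
    tendsto_const_div_atTop_nhds_zero_nat D
  have h3 := h1.sub h2
  refine tendsto_nhds_limUnder ⟨_, h3.congr fun n => ?_⟩
  ring

theorem abs_sub_homogenisation_le {H : Type*} [Group H] {f : H → ℝ} {D : ℝ}
    (hf : ∀ g h : H, |f (g * h) - f g - f h| ≤ D) (g : H) :
    |f g - homogenisation f g| ≤ D := by
  have hD : 0 ≤ D := (abs_nonneg _).trans (hf 1 1)
  have h1 := ((tendsto_const_nhds (x := f g)).sub (tendsto_homogenisation hf g)).abs
  refine le_of_tendsto h1 ?_
  filter_upwards [eventually_gt_atTop 0] with n hn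
  obtain ⟨n, rfl⟩ := Nat.exists_eq_succ_of_ne_zero hn.ne'
  have h2 := abs_pow_sub_nsmul_le hf g n
  have hn : (0 : ℝ) < n + 1 := by positivity
  have h3 : f g - f (g ^ (n + 1)) / ((n + 1 : ℕ) : ℝ) =
      -((f (g ^ (n + 1)) - (n + 1) * f g) / (n + 1)) := by
    push_cast
    field_simp
    ring
  rw [Nat.succ_eq_add_one, h3, abs_neg, abs_div, abs_of_pos hn, div_le_iff₀ hn]
  linarith

theorem IsQuasimorphism.of_abs_sub_le {H : Type*} [Group H] {f q : H → ℝ} {C : ℝ}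
    (hf : IsQuasimorphism f) (h : ∀ g, |f g - q g| ≤ C) : IsQuasimorphism q := by
  obtain ⟨D, hD, hf⟩ := hf
  have hC : 0 ≤ C := (abs_nonneg _).trans (h 1)
  refine ⟨D + 3 * C, by positivity, fun a b => ?_⟩
  have h1 := abs_le.1 (hf a b)
  have h2 := abs_le.1 (h a)
  have h3 := abs_le.1 (h b)
  have h4 := abs_le.1 (h (a * b))
  rw [abs_le]
  constructor <;> linarith [h1.1, h1.2, h2.1, h2.2, h3.1, h3.2, h4.1, h4.2]

theorem IsQuasimorphism.homogenisation {H : Type*} [Group H] {f : H → ℝ}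
    (hf : IsQuasimorphism f) : IsHomogeneousQuasimorphism (homogenisation f) := by
  obtain ⟨D, hD, hfD⟩ := id hf
  refine ⟨hf.of_abs_sub_le (abs_sub_homogenisation_le hfD), ?_⟩
  have hnat : ∀ (g : H) (n : ℕ), _root_.homogenisation f (g ^ n) =
      n * _root_.homogenisation f g := by
    intro g n
    refine tendsto_nhds_unique (tendsto_homogenisation hfD (g ^ n)) ?_
    rcases n with _ | n
    · simp only [pow_zero, one_pow, Nat.cast_zero, zero_mul]
      exact tendsto_const_div_atTop_nhds_zero_nat (f 1)
    · have h1 := ((tendsto_homogenisation hfD g).comp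
        (tendsto_id.const_mul_atTop' (Nat.succ_pos n))).const_mul ((n + 1 : ℕ) : ℝ)
      refine h1.congr fun m => ?_
      simp only [Function.comp, id, Nat.succ_eq_add_one, ← pow_mul]
      rcases eq_or_ne m 0 with rfl | hm
      · simp
      · have : (m : ℝ) ≠ 0 := Nat.cast_ne_zero.2 hm
        push_cast
        field_simp
  have hinv : ∀ g : H, _root_.homogenisation f g⁻¹ = -_root_.homogenisation f g := by
    intro g
    have hb : ∀ g : H, |_root_.homogenisation f g⁻¹ + _root_.homogenisation f g| ≤
        3 * D + |f 1| := by
      intro g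
      have h1 := abs_le.1 (hfD g⁻¹ g)
      have h2 := abs_le.1 (abs_sub_homogenisation_le hfD g)
      have h3 := abs_le.1 (abs_sub_homogenisation_le hfD g⁻¹)
      rw [inv_mul_cancel] at h1
      have h4 := abs_le.1 (le_refl |f 1|)
      rw [abs_le]
      constructor <;> linarith [h1.1, h1.2, h2.1, h2.2, h3.1, h3.2, h4.1, h4.2]
    -- The sum of the values at `g⁻¹` and `g` is bounded uniformly in `g`; at `g ^ n` it is `n`
    -- times the sum at `g`, so it vanishes.
    refine eq_neg_of_add_eq_zero_left
      (eq_zero_of_forall_natCast_mul_le (C := 3 * D + |f 1|) fun n => ?_)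
    have := hb (g ^ n)
    rwa [← inv_pow, hnat, hnat, ← mul_add] at this
  intro g n
  obtain ⟨n, rfl | rfl⟩ := n.eq_nat_or_neg
  · rw [zpow_natCast, hnat, Int.cast_natCast]
  · rw [zpow_neg, zpow_natCast, hinv, hnat]
    push_cast
    ring

/-! ### Gromov products and horofunctions -/

theorem gromovProduct_comm {X : Type*} [MetricSpace X] (w x y : X) :
    gromovProduct w x y = gromovProduct w y x := by
  simp only [gromovProduct, dist_comm x y]
  ring

theorem gromovProduct_nonneg {X : Type*} [MetricSpace X] (w x y : X) :
    0 ≤ gromovProduct w x y := by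
  have := dist_triangle_right x y w
  unfold gromovProduct
  linarith

theorem gromovProduct_le_add_dist {X : Type*} [MetricSpace X] (v w x y : X) :
    gromovProduct w x y ≤ gromovProduct v x y + dist v w := by
  have h1 := dist_triangle x v w
  have h2 := dist_triangle y v w
  unfold gromovProduct
  linarith

theorem gromovProduct_self {X : Type*} [MetricSpace X] (w x : X) :
    gromovProduct w x x = dist x w := by
  simp [gromovProduct]

/-- The hyperbolicity condition freed of its base point: no pair sum of four points exceeds the
larger of the other two by more than `2δ`. -/
theorem dist_add_dist_le_max {X : Type*} [MetricSpace X] {δ : ℝ}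
    (hδ : ∀ w x y z : X,
      min (gromovProduct w x y) (gromovProduct w y z) - δ ≤ gromovProduct w x z)
    (a b p q : X) :
    dist a b + dist p q ≤ max (dist a p + dist b q) (dist a q + dist b p) + 2 * δ := by
  have h := hδ q a p b
  unfold gromovProduct at h
  rw [dist_comm p b] at h
  rcases min_choice ((dist a q + dist p q - dist a p) / 2)
    ((dist p q + dist b q - dist b p) / 2) with h1 | h1 <;> rw [h1] at h
  · linarith [le_max_left (dist a p + dist b q) (dist a q + dist b p)]
  · linarith [le_max_right (dist a p + dist b q) (dist a q + dist b p)]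

/-- Among the three pair sums of `x m`, `y n`, `p`, `q`, the one containing `dist (x m) (y n)` is
far smaller than the others once the Gromov product is large, so the other two agree within `2δ`. -/
theorem GromovClose.exists_forall_abs_sub_le {X : Type*} [MetricSpace X] {δ : ℝ}
    (hδ : ∀ w x y z : X,
      min (gromovProduct w x y) (gromovProduct w y z) - δ ≤ gromovProduct w x z)
    {x y : ℕ → X} (h : GromovClose x y) (p q : X) :
    ∃ N : ℕ, ∀ m ≥ N, ∀ n ≥ N,
      |(dist (x m) p - dist (x m) q) - (dist (y n) p - dist (y n) q)| ≤ 2 * δ := by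
  -- The threshold `dist p q + δ` is what excludes the alternative `dist (x m) (y n) + dist p q` in
  -- both maxima below.
  obtain ⟨a, ha⟩ := eventually_atTop.1 ((h p).eventually_gt_atTop (dist p q + δ))
  refine ⟨max a.1 a.2, fun m hm n hn => ?_⟩
  have h1 := ha (m, n) ⟨(le_max_left _ _).trans hm, (le_max_right _ _).trans hn⟩
  simp only [gromovProduct] at h1
  have h2 := dist_add_dist_le_max hδ (x m) p (y n) q
  have h3 := dist_add_dist_le_max hδ (y n) p (x m) q
  have h4 := dist_triangle (y n) q p
  have h5 := dist_triangle (x m) q p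
  rw [dist_comm (y n) (x m)] at h3
  rw [dist_comm p (y n)] at h2
  rw [dist_comm p (x m)] at h3
  rw [dist_comm q p] at h4 h5
  rw [abs_le]
  constructor
  · rcases le_max_iff.1 (sub_le_iff_le_add.2 h3) with h6 | h6 <;> linarith
  · rcases le_max_iff.1 (sub_le_iff_le_add.2 h2) with h6 | h6 <;> linarith

/-- The eventual bounds also supply the boundedness without which a real `liminf` may be a default
value. -/
theorem abs_liminf_sub_le {u : ℕ → ℝ} {c C : ℝ} (h : ∀ᶠ n in atTop, |u n - c| ≤ C) :
    |liminf u atTop - c| ≤ C := by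
  have h1 : ∀ᶠ n in atTop, c - C ≤ u n := h.mono fun n hn => by linarith [(abs_le.1 hn).1]
  have h2 : ∀ᶠ n in atTop, u n ≤ c + C := h.mono fun n hn => by linarith [(abs_le.1 hn).2]
  have hb : IsBoundedUnder (· ≥ ·) atTop u := ⟨c - C, eventually_map.2 h1⟩
  have hb' : IsBoundedUnder (· ≤ ·) atTop u := ⟨c + C, eventually_map.2 h2⟩
  have h3 : c - C ≤ liminf u atTop := le_liminf_of_le hb'.isCoboundedUnder_ge h1
  have h4 : liminf u atTop ≤ c + C := liminf_le_of_le hb fun b hb => by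
    obtain ⟨n, hn, hn'⟩ := (hb.and h2).exists
    exact hn.trans hn'
  rw [abs_le]
  constructor <;> linarith

theorem GromovClose.eventually_abs_quasiHorofunction_sub_le {X : Type*} [MetricSpace X] {δ : ℝ}
    (hδ : ∀ w x y z : X,
      min (gromovProduct w x y) (gromovProduct w y z) - δ ≤ gromovProduct w x z)
    {x y : ℕ → X} (h : GromovClose x y) (z : X) :
    ∀ᶠ n in atTop,
      |quasiHorofunction x z - (dist (y n) (x 0) - dist (y n) z)| ≤ 2 * δ := by
  obtain ⟨N, hN⟩ := h.exists_forall_abs_sub_le hδ (x 0) z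
  filter_upwards [eventually_ge_atTop N] with n hn
  refine abs_liminf_sub_le ?_
  filter_upwards [eventually_ge_atTop N] with m hm
  exact hN m hm n hn

/-- Arbitrarily late pairs of `x`, `y` have product below some `b`; if `x'` and `y'` had large
products, hyperbolicity along `x, x', y', y` would contradict this. The point is that `M` does not
depend on `x'` and `y'`. -/
theorem exists_eventually_gromovProduct_le {X : Type*} [MetricSpace X] {δ : ℝ}
    (hδ : ∀ w x y z : X,
      min (gromovProduct w x y) (gromovProduct w y z) - δ ≤ gromovProduct w x z)
    {x y : ℕ → X} (h : ¬ GromovClose x y) (w : X) :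
    ∃ M : ℝ, ∀ x' y' : ℕ → X, GromovClose x x' → GromovClose y y' →
      ∀ᶠ n in atTop, gromovProduct w (x' n) (y' n) ≤ M := by
  obtain ⟨v, hv⟩ := not_forall.1 h
  rw [tendsto_atTop] at hv
  push Not at hv
  obtain ⟨b, hb⟩ := hv
  refine ⟨b + 2 * δ + dist v w, fun x' y' hx hy => ?_⟩
  obtain ⟨a, ha⟩ := eventually_atTop.1 ((hx v).eventually_ge_atTop (b + 2 * δ))
  obtain ⟨a', ha'⟩ := eventually_atTop.1 ((hy v).eventually_ge_atTop (b + 2 * δ))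
  obtain ⟨p, hp, hp'⟩ := (hb.and_eventually (eventually_ge_atTop (a.1, a'.1))).exists
  filter_upwards [eventually_ge_atTop a.2, eventually_ge_atTop a'.2] with n hn hn'
  have h1 := ha (p.1, n) ⟨hp'.1, hn⟩
  have h2 := ha' (p.2, n) ⟨hp'.2, hn'⟩
  have h3 := hδ v (x p.1) (x' n) (y p.2)
  have h4 := hδ v (x' n) (y' n) (y p.2)
  have h5 := gromovProduct_le_add_dist v w (x' n) (y' n)
  have hδ0 : 0 ≤ δ := by
    have := hδ v v v v
    rw [min_self] at this
    linarith
  rw [gromovProduct_comm v (y p.2)] at h2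
  simp only at h1 h2
  rcases min_le_iff.1 (sub_le_iff_le_add.1 h3) with h6 | h6
  · linarith
  rcases min_le_iff.1 (sub_le_iff_le_add.1 h4) with h7 | h7 <;> linarith

theorem GromovBoundary.mk_eq_mk {X : Type*} [MetricSpace X] [IsHyperbolicSpace X]
    {x y : GromovSeq X} : GromovBoundary.mk x = GromovBoundary.mk y ↔ GromovClose x.1 y.1 :=
  Quotient.eq (r := gromovSetoid X)

/-- Translating by `g⁻¹` turns the difference of the values at `g h x₀` and `g x₀` into distances
from `g⁻¹ xₙ`, which has the same end as `xₙ`. Each of the three horofunction values costs `2δ`. -/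
theorem abs_quasiHorofunction_mul_sub_le {G X : Type*} [Group G] [MetricSpace X]
    [MulAction G X] [IsIsometricSMul G X] {δ : ℝ}
    (hδ : ∀ w x y z : X,
      min (gromovProduct w x y) (gromovProduct w y z) - δ ≤ gromovProduct w x z)
    {x : ℕ → X} (hx : GromovClose x x) (g h : G) (hg : GromovClose x fun n => g⁻¹ • x n) :
    |quasiHorofunction x ((g * h) • x 0) - quasiHorofunction x (g • x 0) -
      quasiHorofunction x (h • x 0)| ≤ 6 * δ := by
  obtain ⟨n, ⟨h1, h2⟩, h3⟩ :=
    (((hx.eventually_abs_quasiHorofunction_sub_le hδ ((g * h) • x 0)).and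
      (hx.eventually_abs_quasiHorofunction_sub_le hδ (g • x 0))).and
      (hg.eventually_abs_quasiHorofunction_sub_le hδ (h • x 0))).exists
  rw [← dist_smul g (g⁻¹ • x n) (x 0), ← dist_smul g (g⁻¹ • x n) (h • x 0), smul_inv_smul,
    smul_smul] at h3
  rw [abs_le] at *
  constructor <;> linarith [h1.1, h1.2, h2.1, h2.2, h3.1, h3.2]

theorem abs_quasiHorofunction_sub_quasiHorofunction_le {G X : Type*} [Group G] [MetricSpace X]
    [MulAction G X] [IsIsometricSMul G X] {δ : ℝ}
    (hδ : ∀ w x y z : X,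
      min (gromovProduct w x y) (gromovProduct w y z) - δ ≤ gromovProduct w x z)
    {x y : ℕ → X} (hy : GromovClose y y) (hxy : GromovClose x y) (g : G) :
    |quasiHorofunction x (g • x 0) - quasiHorofunction y (g • y 0)| ≤
      4 * δ + 2 * dist (x 0) (y 0) := by
  obtain ⟨n, h1, h2⟩ :=
    ((hxy.eventually_abs_quasiHorofunction_sub_le hδ (g • x 0)).and
      (hy.eventually_abs_quasiHorofunction_sub_le hδ (g • y 0))).exists
  have h3 := abs_le.1 (abs_dist_sub_le (x 0) (y 0) (y n))
  have h4 := abs_le.1 (abs_dist_sub_le (g • x 0) (g • y 0) (y n))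
  rw [dist_smul] at h4
  simp only [dist_comm _ (y n)] at h3 h4
  rw [abs_le] at *
  constructor <;> linarith [h1.1, h1.2, h2.1, h2.2, h3.1, h3.2, h4.1, h4.2]

/-- If `h` fixes the ends of `x` and `y`, and these ends are opposite as seen from `x 0` and
`h • x 0`, then `h` moves `x 0` by roughly the absolute value of its horofunction. -/
theorem dist_smul_le_abs_quasiHorofunction {G X : Type*} [Group G] [MetricSpace X]
    [MulAction G X] {δ M : ℝ}
    (hδ : ∀ w x y z : X,
      min (gromovProduct w x y) (gromovProduct w y z) - δ ≤ gromovProduct w x z)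
    {x y : ℕ → X} (hx : GromovClose x x) (h : G)
    (h0 : ∀ᶠ n in atTop, gromovProduct (x 0) (x n) (y n) ≤ M)
    (h1 : ∀ᶠ n in atTop, gromovProduct (h • x 0) (x n) (y n) ≤ M) :
    |dist (x 0) (h • x 0) - (|quasiHorofunction x (h • x 0)|)| ≤ 4 * δ + 2 * M := by
  obtain ⟨n, ⟨h2, h3⟩, h4⟩ :=
    ((h0.and h1).and (hx.eventually_abs_quasiHorofunction_sub_le hδ (h • x 0))).exists
  have hM : 0 ≤ M := (gromovProduct_nonneg _ _ _).trans h2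
  have hδ0 : 0 ≤ δ := by linarith [(abs_nonneg _).trans h4]
  -- In either case of the maximum, one of the two product bounds eliminates `y n` at the cost of `2
  -- * M`.
  have h5 := dist_add_dist_le_max hδ (x n) (y n) (x 0) (h • x 0)
  have h6 : |dist (x n) (x 0) - dist (x n) (h • x 0)| ≤ dist (x 0) (h • x 0) := by
    have := abs_dist_sub_le (x 0) (h • x 0) (x n)
    simpa only [dist_comm _ (x n)] using this
  have h7 := abs_le.1 (abs_abs_sub_abs_le (quasiHorofunction x (h • x 0))
    (dist (x n) (x 0) - dist (x n) (h • x 0)))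
  have h8 := le_abs_self (dist (x n) (x 0) - dist (x n) (h • x 0))
  have h9 := neg_le_abs (dist (x n) (x 0) - dist (x n) (h • x 0))
  unfold gromovProduct at h2 h3
  rw [abs_le]
  constructor
  · linarith
  · rcases le_max_iff.1 (sub_le_iff_le_add.2 h5) with h10 | h10 <;> linarith

/-- An isometry `t` exchanging two ends reverses horofunctions. -/
theorem abs_quasiHorofunction_conj_add_le {G X : Type*} [Group G] [MetricSpace X]
    [MulAction G X] [IsIsometricSMul G X] {δ M : ℝ}
    (hδ : ∀ w x y z : X,
      min (gromovProduct w x y) (gromovProduct w y z) - δ ≤ gromovProduct w x z)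
    {x : ℕ → X} (hx : GromovClose x x) (t h : G)
    (h0 : ∀ᶠ n in atTop, gromovProduct (x 0) (x n) (t⁻¹ • x n) ≤ M)
    (h1 : ∀ᶠ n in atTop, gromovProduct (h • x 0) (x n) (t⁻¹ • x n) ≤ M) :
    |quasiHorofunction x ((t * h * t⁻¹) • x 0) + quasiHorofunction x (h • x 0)| ≤
      4 * δ + 2 * M + 2 * dist (x 0) (t⁻¹ • x 0) := by
  obtain ⟨n, ⟨⟨h2, h3⟩, h4⟩, h5⟩ :=
    (((h0.and h1).and (hx.eventually_abs_quasiHorofunction_sub_le hδ (h • x 0))).and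
      (hx.eventually_abs_quasiHorofunction_sub_le hδ ((t * h * t⁻¹) • x 0))).exists
  have h6 := gromovProduct_nonneg (x 0) (x n) (t⁻¹ • x n)
  have h7 := gromovProduct_nonneg (h • x 0) (x n) (t⁻¹ • x n)
  -- Moved by `t⁻¹`, the value at `tht⁻¹ x₀` is read off from `t⁻¹ xₙ` at `h t⁻¹ x₀`, which is near
  -- `h x₀`. Products between `0` and `M` then make the distances to `xₙ` and `t⁻¹ xₙ` nearly
  -- complementary.
  have h10 : t⁻¹ • (t * h * t⁻¹) • x 0 = h • t⁻¹ • x 0 := by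
    simp only [mul_smul, inv_smul_smul]
  rw [← dist_smul t⁻¹ (x n) (x 0), ← dist_smul t⁻¹ (x n) ((t * h * t⁻¹) • x 0), h10] at h5
  have h8 := abs_le.1 (abs_dist_sub_le (x 0) (t⁻¹ • x 0) (t⁻¹ • x n))
  have h9 := abs_le.1 (abs_dist_sub_le (h • x 0) (h • t⁻¹ • x 0) (t⁻¹ • x n))
  rw [dist_smul] at h9
  simp only [dist_comm _ (t⁻¹ • x n)] at h8 h9
  unfold gromovProduct at h2 h3 h6 h7
  rw [abs_le] at *
  constructor <;> linarith [h4.1, h4.2, h5.1, h5.2, h8.1, h8.2, h9.1, h9.2]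

/-! ### Quasi-isometries with the real line -/

/-- A discrete intermediate value argument, as `φ` need not be continuous. The increment of `φ` over
length `R` has size at least `2(K + ε) + 1` but changes by at most `2(K + ε)` when its start moves
by `1`, so it keeps its sign along the integers. -/
theorem IsQIEmbeddingWith.exists_abs_sub_le_of_pos {K ε : ℝ} {φ : ℝ → ℝ}
    (h : IsQIEmbeddingWith K ε φ) {R : ℕ} (hR : K * (2 * (K + ε) + 1 + ε) ≤ R)
    (hpos : 0 < φ R - φ 0) (v : ℝ) : ∃ s, |v - φ s| ≤ K * R + ε := by
  have hK : 0 < K := zero_lt_one.trans_le h.one_le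
  have hstep : ∀ s : ℝ, |φ (s + 1) - φ s| ≤ K + ε := fun s => by
    have := h.upper (s + 1) s
    simpa [Real.dist_eq] using this
  have hlow : ∀ s : ℝ, 2 * (K + ε) + 1 ≤ |φ (s + R) - φ s| := fun s => by
    have h1 := h.lower (s + R) s
    simp only [Real.dist_eq, add_sub_cancel_left, Nat.abs_cast] at h1
    have h2 : 2 * (K + ε) + 1 + ε ≤ 1 / K * R := by
      rw [one_div_mul_eq_div, le_div_iff₀ hK]
      linarith
    linarith
  have hup : ∀ s : ℝ, φ (s + R) - φ s ≤ K * R + ε := fun s => by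
    have h1 := h.upper (s + R) s
    simp only [Real.dist_eq, add_sub_cancel_left, Nat.abs_cast] at h1
    exact (le_abs_self _).trans h1
  have hstep2 : ∀ s : ℝ, |(φ (s + 1 + R) - φ (s + 1)) - (φ (s + R) - φ s)| ≤ 2 * (K + ε) :=
    fun s => by
      have h1 := abs_le.1 (hstep s)
      have h2 := abs_le.1 (hstep (s + R))
      rw [add_right_comm s (R : ℝ) 1] at h2
      rw [abs_le]
      constructor <;> linarith [h1.1, h1.2, h2.1, h2.2]
  have hincr : ∀ n : ℤ, 0 < φ (n + R) - φ n := by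
    intro n
    induction n using Int.induction_on with
    | zero => simpa using hpos
    | succ n ih =>
      have h1 := abs_le.1 (hstep2 n)
      have h2 := hlow n
      rw [Int.cast_natCast] at ih
      rw [abs_of_pos ih] at h2
      push_cast
      linarith [h1.1]
    | pred n ih =>
      have h1 := abs_le.1 (hstep2 (-n - 1))
      have h2 := hlow (-n)
      push_cast at ih ⊢
      rw [abs_of_pos ih] at h2
      rw [sub_add_cancel] at h1
      linarith [h1.2]
  have hb : ∀ k : ℤ, φ (k * R) + 1 ≤ φ ((k + 1 : ℤ) * R) := by
    intro k
    have h1 := hincr (k * R)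
    have h2 := hlow (k * R)
    push_cast at h1 ⊢
    rw [abs_of_pos h1] at h2
    rw [add_mul, one_mul]
    linarith [h.nonneg]
  have hb0 : ∀ n : ℕ, φ 0 + n ≤ φ ((n : ℤ) * R) ∧ φ ((-n : ℤ) * R) ≤ φ 0 - n := by
    intro n
    induction n with
    | zero => simp
    | succ n ih =>
      have h1 := hb n
      have h2 := hb (-n - 1)
      rw [sub_add_cancel] at h2
      rw [show -((n + 1 : ℕ) : ℤ) = -n - 1 by push_cast; ring]
      push_cast at *
      exact ⟨by linarith [ih.1], by linarith [ih.2]⟩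
  -- The values at multiples of `R` grow by at least `1` per step, so they cross `v`; the jump at
  -- the crossing is at most `K * R + ε`.
  obtain ⟨k, hk, hk'⟩ := Int.exists_greatest_of_bdd (P := fun k : ℤ => φ (k * R) ≤ v)
    (by
      obtain ⟨N, hN⟩ := exists_nat_gt (v - φ 0)
      refine ⟨N, fun z hz => ?_⟩
      by_contra! hlt
      obtain ⟨m, rfl⟩ := Int.eq_ofNat_of_zero_le ((Nat.cast_nonneg N).trans hlt.le)
      have h1 := (hb0 m).1
      have h2 : (N : ℝ) < m := by exact_mod_cast hlt
      linarith)
    (by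
      obtain ⟨N, hN⟩ := exists_nat_gt (φ 0 - v)
      refine ⟨-N, ?_⟩
      have h1 := (hb0 N).2
      push_cast at h1 ⊢
      linarith)
  refine ⟨k * R, ?_⟩
  have h1 : v < φ ((k + 1 : ℤ) * R) := by
    by_contra! hle
    have := hk' (k + 1) hle
    linarith
  have h2 := hup (k * R)
  push_cast at h1
  rw [add_mul, one_mul] at h1
  rw [abs_of_nonneg (sub_nonneg.2 hk)]
  linarith

/-- Quasi-isometric embeddings of the line into itself are coarsely onto. -/
theorem IsQIEmbeddingWith.exists_forall_abs_sub_le {K ε : ℝ} {φ : ℝ → ℝ}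
    (h : IsQIEmbeddingWith K ε φ) : ∃ C : ℝ, ∀ v, ∃ s, |v - φ s| ≤ C := by
  have hK : 0 < K := zero_lt_one.trans_le h.one_le
  obtain ⟨R, hR⟩ := exists_nat_ge (K * (2 * (K + ε) + 1 + ε))
  refine ⟨K * R + ε, fun v => ?_⟩
  have hne : φ R - φ 0 ≠ 0 := by
    intro h0
    have h1 := h.lower R 0
    simp only [Real.dist_eq, h0, sub_zero, abs_zero, Nat.abs_cast] at h1
    have h2 : 2 * (K + ε) + 1 + ε ≤ 1 / K * R := by
      rw [one_div_mul_eq_div, le_div_iff₀ hK]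
      linarith
    linarith [h.nonneg]
  rcases hne.lt_or_gt with hlt | hgt
  · have h' : IsQIEmbeddingWith K ε fun s => -φ s :=
      ⟨h.one_le, h.nonneg, fun x y => by simpa only [dist_neg_neg] using h.lower x y,
        fun x y => by simpa only [dist_neg_neg] using h.upper x y⟩
    obtain ⟨s, hs⟩ := h'.exists_abs_sub_le_of_pos hR (by linarith) (-v)
    refine ⟨s, ?_⟩
    rw [← abs_neg]
    convert hs using 2
    ring
  · exact h.exists_abs_sub_le_of_pos hR hgt v

theorem IsQIEmbeddingWith.comp {X Y Z : Type*} [MetricSpace X] [MetricSpace Y] [MetricSpace Z]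
    {K ε K' ε' : ℝ} {f : Y → Z} {g : X → Y} (hf : IsQIEmbeddingWith K ε f)
    (hg : IsQIEmbeddingWith K' ε' g) : IsQIEmbeddingWith (K * K') (K * ε' + ε) (f ∘ g) := by
  have hK : 0 < K := zero_lt_one.trans_le hf.one_le
  have hK' : 0 < K' := zero_lt_one.trans_le hg.one_le
  refine ⟨one_le_mul_of_one_le_of_one_le hf.one_le hg.one_le,
    add_nonneg (mul_nonneg hK.le hg.nonneg) hf.nonneg, fun x y => ?_, fun x y => ?_⟩
  · have h1 := mul_le_mul_of_nonneg_left (hg.lower x y) (one_div_pos.2 hK).le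
    have h2 := hf.lower (g x) (g y)
    have h3 : 1 / K * ε' ≤ K * ε' := by
      refine mul_le_mul_of_nonneg_right ?_ hg.nonneg
      rw [div_le_iff₀ hK]
      nlinarith [hf.one_le]
    have h4 : 1 / (K * K') * dist x y = 1 / K * (1 / K' * dist x y) := by
      field_simp
    rw [mul_sub] at h1
    simp only [Function.comp]
    rw [h4]
    linarith
  · have h1 := mul_le_mul_of_nonneg_left (hg.upper x y) hK.le
    have h2 := hf.upper (g x) (g y)
    simp only [Function.comp]
    linarith

theorem IsQIEmbeddingWith.dist_le {X Y : Type*} [MetricSpace X] [MetricSpace Y] {K ε : ℝ}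
    {q : X → Y} (h : IsQIEmbeddingWith K ε q) (x y : X) :
    dist x y ≤ K * (dist (q x) (q y) + ε) := by
  have hK : 0 < K := zero_lt_one.trans_le h.one_le
  have h1 := h.lower x y
  rw [one_div_mul_eq_div, sub_le_iff_le_add, div_le_iff₀ hK] at h1
  linarith

theorem IsQuasiIsometry.exists_inverse {X Y : Type*} [MetricSpace X] [MetricSpace Y] {q : X → Y}
    (h : IsQuasiIsometry q) : ∃ r : Y → X, IsQuasiIsometry r := by
  obtain ⟨K, ε, C, hq, hC, ⟨_, x₀, rfl⟩, hd⟩ := h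
  have hd' : ∀ y, ∃ x, dist y (q x) ≤ C := fun y => by
    obtain ⟨_, ⟨x, rfl⟩, hx⟩ := hd y
    exact ⟨x, hx⟩
  choose r hr using hd'
  have hK : 0 < K := zero_lt_one.trans_le hq.one_le
  have hε := hq.nonneg
  refine ⟨r, K, K * (2 * C + ε), K * (C + ε), ⟨hq.one_le, by positivity, fun y z => ?_,
    fun y z => ?_⟩, by positivity, ⟨⟨r (q x₀), q x₀, rfl⟩, fun x => ⟨_, ⟨q x, rfl⟩, ?_⟩⟩⟩
  · have h1 := dist_triangle4 y (q (r y)) (q (r z)) z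
    have h2 := hr y
    have h3 := hr z
    rw [dist_comm] at h3
    have h4 := hq.upper (r y) (r z)
    have h5 : dist y z ≤ K * dist (r y) (r z) + (2 * C + ε) := by linarith
    have h6 : 2 * C + ε ≤ K * (K * (2 * C + ε)) := by
      rw [← mul_assoc]
      exact le_mul_of_one_le_left (by positivity)
        (one_le_mul_of_one_le_of_one_le hq.one_le hq.one_le)
    rw [one_div_mul_eq_div, sub_le_iff_le_add, div_le_iff₀ hK]
    linarith
  · have h1 := dist_triangle4 (q (r y)) y z (q (r z))
    have h2 := hr y
    have h3 := hr z
    rw [dist_comm] at h2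
    have h4 := hq.dist_le (r y) (r z)
    have h5 : K * (dist (q (r y)) (q (r z)) + ε) ≤ K * (dist y z + 2 * C + ε) :=
      mul_le_mul_of_nonneg_left (by linarith) hK.le
    linarith
  · refine (hq.dist_le _ _).trans (mul_le_mul_of_nonneg_left ?_ hK.le)
    linarith [hr (q x)]

/-! ### Reduction to the dihedral quasi-action -/

/-- Every group element acts as a translation or a reflection, so only the product rule needs work.
Antisymmetry moves elements of `H` past `t`; for two reflections it leaves two defects and the value
at `t * t`, whence the constant. -/
theorem IsHomogeneousQuasimorphism.isQuasiAction_dihedral {G : Type*} [Group G] {H : Subgroup G}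
    (hH : H.index = 2) {q : H → ℝ} (hq : IsHomogeneousQuasimorphism q)
    (hanti : IsAntisymmetricIn H hH q) {t : G} (ht : t ∉ H) :
    IsQuasiAction (dihedralQuasiAction H hH q t ht) := by
  obtain ⟨D, hD, hqD⟩ := hq.1
  have hq1 : q 1 = 0 := by simpa using hq.2 1 0
  have hq1' : q ⟨1, H.one_mem⟩ = 0 := hq1
  have htt : t * t ∈ H := Subgroup.mul_self_mem_of_index_two hH t
  have hN : H.Normal := Subgroup.normal_of_index_eq_two hH
  have hmem : ∀ {a b : G}, a * b ∈ H ↔ (a ∈ H ↔ b ∈ H) :=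
    fun {a b} => Subgroup.mul_mem_iff_of_index_two hH
  have ht' : t⁻¹ ∉ H := fun h => ht (inv_mem_iff.1 h)
  have habs : ∀ a b c : H, a * b = c → q c - q a - q b ≤ D ∧ -D ≤ q c - q a - q b := by
    rintro a b _ rfl
    exact (abs_le.1 (hqD a b)).symm
  have hC : 0 ≤ 2 * D + |q ⟨t * t, htt⟩| := by positivity
  refine ⟨1, 0, 2 * D + |q ⟨t * t, htt⟩|, fun g => ?_, fun x => ?_, fun x g h => ?_⟩
  · by_cases hg : g ∈ H
    · refine ⟨⟨le_rfl, le_rfl, fun x y => ?_, fun x y => ?_⟩, hC, Set.range_nonempty _,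
        fun x => ⟨x, ⟨x - q ⟨g, hg⟩, ?_⟩, by simpa using hC⟩⟩ <;>
      simp [dihedralQuasiAction, hg]
    · refine ⟨⟨le_rfl, le_rfl, fun x y => ?_, fun x y => ?_⟩, hC, Set.range_nonempty _,
        fun x => ⟨x, ⟨-x - q ⟨t⁻¹ * g, hmem.2 (iff_of_false ht' hg)⟩, ?_⟩, by simpa using hC⟩⟩ <;>
      simp [dihedralQuasiAction, hg]
  · simpa [dihedralQuasiAction, H.one_mem, hq1'] using hC
  · rw [Real.dist_eq]
    by_cases hg : g ∈ H <;> by_cases hh : h ∈ H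
    · have hgh := H.mul_mem hg hh
      have h1 := habs ⟨g, hg⟩ ⟨h, hh⟩ ⟨g * h, hgh⟩ rfl
      have h2 := abs_nonneg (q ⟨t * t, htt⟩)
      simp only [dihedralQuasiAction, hg, hh, hgh, dif_pos]
      rw [abs_le]
      constructor <;> linarith [h1.1, h1.2]
    · have hgh : g * h ∉ H := fun h => hh ((hmem.1 h).1 hg)
      have hc : t⁻¹ * g * t ∈ H := by simpa using hN.conj_mem g hg t⁻¹
      have h1 := habs ⟨t⁻¹ * g * t, hc⟩ ⟨t⁻¹ * h, hmem.2 (iff_of_false ht' hh)⟩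
        ⟨t⁻¹ * (g * h), hmem.2 (iff_of_false ht' hgh)⟩
          (Subtype.ext (by simp only [Subgroup.coe_mul]; group))
      have h2 := abs_nonneg (q ⟨t * t, htt⟩)
      have h3 := hanti t ht ⟨t⁻¹ * g * t, hc⟩
      have h4 : (⟨t * (t⁻¹ * g * t) * t⁻¹, hN.conj_mem _ hc t⟩ : H) = ⟨g, hg⟩ :=
        Subtype.ext (by simp only; group)
      rw [h4] at h3
      simp only [dihedralQuasiAction, hg, hh, hgh, dif_pos, dif_neg, not_false_eq_true]
      rw [abs_le]
      constructor <;> linarith [h1.1, h1.2]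
    · have hgh : g * h ∉ H := fun h => hg ((hmem.1 h).2 hh)
      have h1 := habs ⟨t⁻¹ * g, hmem.2 (iff_of_false ht' hg)⟩ ⟨h, hh⟩
        ⟨t⁻¹ * (g * h), hmem.2 (iff_of_false ht' hgh)⟩
          (Subtype.ext (by simp only [Subgroup.coe_mul]; group))
      have h2 := abs_nonneg (q ⟨t * t, htt⟩)
      simp only [dihedralQuasiAction, hg, hh, hgh, dif_pos, dif_neg, not_false_eq_true]
      rw [abs_le]
      constructor <;> linarith [h1.1, h1.2]
    · have hgh : g * h ∈ H := hmem.2 (iff_of_false hg hh)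
      have hg' : t⁻¹ * g ∈ H := hmem.2 (iff_of_false ht' hg)
      have hh' : t⁻¹ * h ∈ H := hmem.2 (iff_of_false ht' hh)
      have h1 := habs ⟨t * (t⁻¹ * g) * t⁻¹, hN.conj_mem _ hg' t⟩
        ⟨t * t * (t⁻¹ * h), H.mul_mem htt hh'⟩ ⟨g * h, hgh⟩
          (Subtype.ext (by simp only [Subgroup.coe_mul]; group))
      have h2 := habs ⟨t * t, htt⟩ ⟨t⁻¹ * h, hh'⟩ ⟨t * t * (t⁻¹ * h), H.mul_mem htt hh'⟩ rfl
      have h3 := hanti t ht ⟨t⁻¹ * g, hg'⟩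
      simp only at h3
      rw [h3] at h1
      have h4 := abs_le.1 (le_refl |q ⟨t * t, htt⟩|)
      simp only [dihedralQuasiAction, hg, hh, hgh, dif_pos, dif_neg, not_false_eq_true]
      rw [abs_le]
      constructor <;> linarith [h1.1, h1.2, h2.1, h2.2, h4.1, h4.2]

/-- If `|q|` measures the displacement of `x₀` up to bounded error, then the powers of an element
with nonzero `q` trace out a coarsely equivariant quasi-isometric embedding of the line. -/
theorem exists_isReductionMap_of_abs_dist_sub_le {G X : Type*} [Group G] [MetricSpace X]
    [MulAction G X] [IsIsometricSMul G X] {H : Subgroup G}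
    (hH : H.index = 2) {q : H → ℝ} (hq : IsHomogeneousQuasimorphism q)
    (hanti : IsAntisymmetricIn H hH q) {x₀ : X} {C : ℝ}
    (hC : ∀ h : H, |dist x₀ (h • x₀) - (|q h|)| ≤ C) {a : H} (ha : q a ≠ 0) :
    ∃ F : ℝ → X, (∀ s, ∃ g : G, F s = g • x₀) ∧ ∀ (t : G) (ht : t ∉ H),
      IsReductionMap (fun (g : G) (x : X) => g • x) (dihedralQuasiAction H hH q t ht) F := by
  obtain ⟨D, hD, hqD⟩ := hq.1
  have : IsIsometricSMul H X := ⟨fun h => isometry_smul X (h : G)⟩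
  have hC0 : 0 ≤ C := (abs_nonneg _).trans (hC 1)
  have hinv : ∀ g : H, q g⁻¹ = -q g := fun g => by simpa using hq.2 g (-1)
  have hdist : ∀ g h : H, |dist (g • x₀) (h • x₀) - (|q g - q h|)| ≤ C + D := by
    intro g h
    have h1 := hC (g⁻¹ * h)
    have h2 := hqD g⁻¹ h
    have h3 : dist x₀ ((g⁻¹ * h) • x₀) = dist (g • x₀) (h • x₀) := by
      rw [← dist_smul g, smul_smul, mul_inv_cancel_left]
    have h4 := abs_abs_sub_abs_le (q (g⁻¹ * h)) (q h - q g)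
    rw [hinv] at h2
    rw [h3] at h1
    rw [abs_sub_comm (q g)]
    have h5 : |q (g⁻¹ * h) - (q h - q g)| ≤ D := by
      convert h2 using 2
      ring
    have h6 := abs_le.1 (h4.trans h5)
    rw [abs_le] at *
    constructor <;> linarith [h1.1, h1.2, h6.1, h6.2]
  -- The exponent for which `q (a ^ k s)` is within `|q a|` of `s`.
  let k : ℝ → ℤ := fun s => ⌊s / q a⌋
  have hk : ∀ s, |k s * q a - s| ≤ |q a| := by
    intro s
    have h1 : |(k s : ℝ) - s / q a| ≤ 1 := by
      have h2 := Int.floor_le (s / q a)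
      have h3 := Int.lt_floor_add_one (s / q a)
      rw [abs_le]
      constructor <;> simp only [k] <;> linarith
    have h2 : k s * q a - s = (k s - s / q a) * q a := by field_simp
    rw [h2, abs_mul]
    exact mul_le_of_le_one_left (abs_nonneg _) h1
  have hk' : ∀ s, q (a ^ k s) = k s * q a := fun s => hq.2 a _
  have hclose : ∀ (s : ℝ) (h : H), dist (a ^ k s • x₀) (h • x₀) ≤ |s - q h| + |q a| + C + D := by
    intro s h
    have h1 := (abs_le.1 (hdist (a ^ k s) h)).2
    have h2 := hk s
    rw [hk'] at h1
    have h3 := abs_add_le (k s * q a - s) (s - q h)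
    rw [sub_add_sub_cancel] at h3
    linarith
  refine ⟨fun s => a ^ k s • x₀, fun s => ⟨((a ^ k s : H) : G), rfl⟩, fun t ht => ⟨?_, ?_⟩⟩
  · refine ⟨1, C + D + 2 * |q a|, le_rfl, by positivity, fun s s' => ?_, fun s s' => ?_⟩ <;>
    · have h1 := abs_le.1 (hdist (a ^ k s) (a ^ k s'))
      rw [hk', hk'] at h1
      have h2 := hk s
      have h3 := hk s'
      have h4 := abs_abs_sub_abs_le (k s * q a - k s' * q a) (s - s')
      have h5 := abs_sub (k s * q a - s) (k s' * q a - s')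
      rw [show k s * q a - s - (k s' * q a - s') = k s * q a - k s' * q a - (s - s') by ring] at h5
      have h6 := abs_le.1 (h4.trans h5)
      rw [Real.dist_eq]
      linarith [h1.1, h1.2, h6.1, h6.2]
  · refine ⟨2 * |q a| + C + 2 * D + dist x₀ (t⁻¹ • x₀), by positivity, fun s g => ?_⟩
    have h0 := hk s
    have h00 : 0 ≤ dist x₀ (t⁻¹ • x₀) := dist_nonneg
    by_cases hg : g ∈ H
    · simp only [dihedralQuasiAction, hg, dif_pos]
      have h1 := hclose (s + q ⟨g, hg⟩) (⟨g, hg⟩ * a ^ k s)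
      have h2 := hqD ⟨g, hg⟩ (a ^ k s)
      rw [mul_smul] at h1
      have h4 : dist (a ^ k (s + q ⟨g, hg⟩) • x₀) (g • a ^ k s • x₀) ≤ _ := h1
      have h3 : |s + q ⟨g, hg⟩ - q (⟨g, hg⟩ * a ^ k s)| ≤ |q a| + D := by
        rw [hk'] at h2
        rw [abs_le] at *
        constructor <;> linarith [h0.1, h0.2, h2.1, h2.2]
      linarith
    · have hg' : t⁻¹ * g ∈ H := (Subgroup.mul_mem_iff_of_index_two hH).2
        (iff_of_false (fun h => ht (inv_mem_iff.1 h)) hg)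
      simp only [dihedralQuasiAction, hg, dif_neg, not_false_eq_true]
      set b : H := ⟨t⁻¹ * g, hg'⟩ with hb
      -- With this `c ∈ H` one has `g a^k x₀ = c t x₀`, within a fixed distance of `c x₀`, and
      -- antisymmetry gives `q c`.
      set c : H := ⟨t * (b * a ^ k s : H) * t⁻¹,
        (Subgroup.normal_of_index_eq_two hH).conj_mem _ (b * a ^ k s : H).2 t⟩ with hc
      have h1 : q c = -q (b * a ^ k s) := hanti t ht (b * a ^ k s)
      have h2 := hclose (-s - q b) c
      have h3 := hqD b (a ^ k s)
      have h4 : |-s - q b - q c| ≤ |q a| + D := by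
        rw [hk'] at h3
        rw [h1]
        rw [abs_le] at *
        constructor <;> linarith [h0.1, h0.2, h3.1, h3.2]
      have h5 : g • a ^ k s • x₀ = c • t • x₀ := by
        simp only [hc, hb, Subgroup.smul_def, smul_smul, Subgroup.coe_mul]
        congr 1
        group
      have h6 : dist (c • x₀) (c • t • x₀) = dist x₀ (t⁻¹ • x₀) := by
        rw [dist_smul, ← dist_smul t⁻¹, inv_smul_smul, dist_comm]
      have h7 := dist_triangle (a ^ k (-s - q b) • x₀) (c • x₀) (c • t • x₀)
      rw [h5]
      linarith

/-- The image of `F` nearly contains the orbit of `F y`, which is parallel to the given coarse dense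
orbit. -/
theorem IsReductionMap.isEquivalenceMap {G X Y : Type*} [Group G] [MetricSpace X] [MetricSpace Y]
    [Nonempty Y] [MulAction G X] [IsIsometricSMul G X] {α : G → Y → Y} {F : Y → X}
    (hF : IsReductionMap (fun (g : G) (x : X) => g • x) α F)
    (hG : IsCoboundedAction (fun (g : G) (x : X) => g • x)) :
    IsEquivalenceMap (fun (g : G) (x : X) => g • x) α F := by
  obtain ⟨⟨K, ε, hqi⟩, M, hM, hFM⟩ := hF
  obtain ⟨x₁, C, hC, -, hd⟩ := hG
  obtain ⟨y⟩ := ‹Nonempty Y›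
  refine ⟨⟨K, ε, C + dist x₁ (F y) + M, hqi, by positivity, ⟨F y, y, rfl⟩, fun x => ?_⟩,
    M, hM, hFM⟩
  obtain ⟨_, ⟨g, rfl⟩, hg⟩ := hd x
  refine ⟨_, ⟨α g y, rfl⟩, ?_⟩
  have h1 := hFM y g
  rw [dist_comm] at h1
  have h2 := dist_triangle4 x (g • x₁) (g • F y) (F (α g y))
  rw [dist_smul] at h2
  simp only at hg h1
  linarith

/-- Composing `F` with a quasi-isometry `X → ℝ` gives a self-embedding of the line, hence a coarsely
onto map; so the image of `F`, which lies in one orbit, is coarse dense. -/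
theorem IsQuasiLine.isCoboundedAction {G X : Type*} [Group G] [MetricSpace X] [MulAction G X]
    (hX : IsQuasiLine X) {F : ℝ → X} (hF : IsQIEmbedding F) {x₀ : X}
    (horb : ∀ s, ∃ g : G, F s = g • x₀) :
    IsCoboundedAction (fun (g : G) (x : X) => g • x) := by
  obtain ⟨-, f, K, ε, -, hf, -⟩ := hX
  obtain ⟨K', ε', hF⟩ := hF
  obtain ⟨C, hC⟩ := (hf.comp hF).exists_forall_abs_sub_le
  have hK : 0 < K := zero_lt_one.trans_le hf.one_le
  have hC0 : 0 ≤ C := (abs_nonneg _).trans (hC 0).choose_spec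
  have hε := hf.nonneg
  refine ⟨x₀, K * (C + ε) + 1, by positivity, ⟨(1 : G) • x₀, 1, rfl⟩, fun x => ?_⟩
  obtain ⟨s, hs⟩ := hC (f x)
  obtain ⟨g, hg⟩ := horb s
  refine ⟨g • x₀, ⟨g, rfl⟩, ?_⟩
  have h1 := hf.dist_le x (F s)
  rw [Real.dist_eq] at h1
  have h2 := mul_le_mul_of_nonneg_left (add_le_add_left hs ε) hK.le
  simp only [Function.comp] at h2
  rw [← hg]
  linarith

/-! ### Actions of type (3)⁻ -/

theorem smul_mem_limitSet {G X : Type*} [Group G] [MetricSpace X] [IsHyperbolicSpace X]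
    [MulAction G X] [IsIsometricSMul G X] (g : G) {ζ : GromovBoundary X}
    (hζ : ζ ∈ limitSet G X) : g • ζ ∈ limitSet G X := by
  obtain ⟨x₀, γ, h, rfl⟩ := hζ
  have h' : (fun n => g • γ n • x₀) = fun n => (g * γ n) • x₀ :=
    funext fun n => smul_smul _ _ _
  refine ⟨x₀, fun n => g * γ n, h' ▸ h.smul g, ?_⟩
  exact congrArg GromovBoundary.mk (Subtype.ext h')

/-- The two-point limit set is invariant, so by injectivity an element fixing `ζ` fixes the other
point as well. -/
theorem IsTypeThreeMinus.exists_swap {G X : Type*} [Group G] [MetricSpace X]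
    [IsHyperbolicSpace X] [MulAction G X] [IsIsometricSMul G X] (hG : IsTypeThreeMinus G X)
    {ζ : GromovBoundary X} (hζ : ζ ∈ limitSet G X) :
    ∃ ξ, ξ ≠ ζ ∧ (∀ g : G, g • ζ = ζ ∨ g • ζ = ξ) ∧ (∃ g : G, g • ξ = ζ) ∧
      (∀ g : G, g ∈ orientationPreserving G X ↔ g • ζ = ζ) := by
  obtain ⟨h2, g₀, ζ₀, hζ₀, hg₀⟩ := hG
  obtain ⟨u, v, huv, hL⟩ := Set.encard_eq_two.1 h2
  obtain ⟨ξ, hξ, hL⟩ : ∃ ξ, ξ ≠ ζ ∧ limitSet G X = {ζ, ξ} := by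
    rw [hL] at hζ
    rcases hζ with rfl | rfl
    · exact ⟨v, huv.symm, hL⟩
    · exact ⟨u, huv, by rw [hL, Set.pair_comm]⟩
  have hmem : ∀ {η : GromovBoundary X}, η ∈ limitSet G X → η = ζ ∨ η = ξ := fun h => by
    rwa [hL] at h
  have hξL : ξ ∈ limitSet G X := hL ▸ Set.mem_insert_of_mem _ rfl
  have hfix : ∀ g : G, g • ζ = ζ → g • ξ = ξ := fun g hg =>
    (hmem (smul_mem_limitSet g hξL)).resolve_left fun h =>
      hξ (MulAction.injective g (h.trans hg.symm))
  have hiff : ∀ g : G, g ∈ orientationPreserving G X ↔ g • ζ = ζ := by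
    intro g
    rw [orientationPreserving, mem_fixingSubgroup_iff]
    refine ⟨fun h => h ζ (hL ▸ Set.mem_insert _ _), fun h η hη => ?_⟩
    rcases hmem hη with rfl | rfl
    · exact h
    · exact hfix g h
  refine ⟨ξ, hξ, fun g => hmem (smul_mem_limitSet g (hL ▸ Set.mem_insert _ _)), ⟨g₀⁻¹, ?_⟩, hiff⟩
  rw [inv_smul_eq_iff]
  by_contra h
  have h1 : g₀ • ζ = ζ := (hmem (smul_mem_limitSet g₀ (hL ▸ Set.mem_insert _ _))).resolve_right
    (Ne.symm h)
  rcases hmem hζ₀ with rfl | rfl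
  · exact hg₀ h1
  · exact hg₀ (hfix _ h1)

theorem IsTypeThreeMinus.index_orientationPreserving {G X : Type*} [Group G] [MetricSpace X]
    [IsHyperbolicSpace X] [MulAction G X] [IsIsometricSMul G X] (hG : IsTypeThreeMinus G X)
    {ζ : GromovBoundary X} (hζ : ζ ∈ limitSet G X) : (orientationPreserving G X).index = 2 := by
  obtain ⟨ξ, hξ, hor, ⟨t, ht⟩, hiff⟩ := hG.exists_swap hζ
  have htζ : t • ζ = ξ := (hor t).resolve_left fun h => hξ (MulAction.injective t (ht.trans h.symm))
  refine Subgroup.index_eq_two_iff.2 ⟨t, fun b => ?_⟩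
  rw [hiff, hiff, mul_smul, htζ]
  rcases hor b with h | h
  · exact Or.inr ⟨h, fun h' => hξ (MulAction.injective b (h'.trans h.symm))⟩
  · refine Or.inl ⟨?_, fun h' => hξ (h.symm.trans h')⟩
    have h1 := hor (b * t)
    rw [mul_smul, htζ] at h1
    exact h1.resolve_right fun h' => hξ (MulAction.injective b (h'.trans h.symm))

/-- If the limit set of `G` is nonempty, a subgroup of index 2 has unbounded orbits. -/
theorem exists_lt_dist_smul_of_mem_limitSet {G X : Type*} [Group G] [MetricSpace X]
    [IsHyperbolicSpace X] [MulAction G X] [IsIsometricSMul G X] {ζ : GromovBoundary X}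
    (hζ : ζ ∈ limitSet G X) {H : Subgroup G} (hH : H.index = 2) (x₀ : X) (C : ℝ) :
    ∃ h : H, C < dist x₀ (h • x₀) := by
  by_contra! hb
  obtain ⟨x₁, γ, h, -⟩ := hζ
  obtain ⟨t, ht⟩ := Subgroup.index_eq_two_iff.1 hH
  -- Either `g` or `g * t` lies in `H`, so a bound on the `H`-orbit bounds the whole `G`-orbit.
  have hbd : ∀ g : G, dist (g • x₀) x₀ ≤ C + dist x₀ (t • x₀) := by
    intro g
    rcases ht g with ⟨h1, -⟩ | ⟨h1, -⟩
    · have h2 := hb ⟨g * t, h1⟩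
      have h3 := dist_triangle_right (g • x₀) x₀ ((g * t) • x₀)
      rw [mul_smul, dist_smul] at h3
      rw [Subgroup.mk_smul, mul_smul] at h2
      linarith
    · have h2 := hb ⟨g, h1⟩
      rw [Subgroup.mk_smul, dist_comm] at h2
      linarith [dist_nonneg (x := x₀) (y := t • x₀)]
  have h1 := (h x₀).comp (show Tendsto (fun n : ℕ => (n, n)) atTop atTop by
    rw [← prod_atTop_atTop_eq]
    exact tendsto_id.prodMk tendsto_id)
  obtain ⟨n, hn⟩ := (h1.eventually_gt_atTop (dist x₁ x₀ + (C + dist x₀ (t • x₀)))).exists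
  simp only [Function.comp, gromovProduct_self] at hn
  have h2 := dist_triangle (γ n • x₁) (γ n • x₀) x₀
  rw [dist_smul] at h2
  linarith [hbd (γ n)]

theorem gromovProduct_smul {G X : Type*} [Group G] [MetricSpace X] [MulAction G X]
    [IsIsometricSMul G X] (g : G) (w x y : X) :
    gromovProduct (g • w) x y = gromovProduct w (g⁻¹ • x) (g⁻¹ • y) := by
  have h : ∀ a : X, dist (g⁻¹ • a) w = dist a (g • w) := fun a => by
    rw [← dist_smul g, smul_inv_smul]
  simp only [gromovProduct, h, dist_smul]

/-- The Gromov product of the end of `x` and its image under `t⁻¹`, seen from the translates of `w`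
by the elements fixing both ends, is bounded. -/
theorem exists_forall_eventually_gromovProduct_smul_le {G X : Type*} [Group G] [MetricSpace X]
    [IsHyperbolicSpace X] [MulAction G X] [IsIsometricSMul G X] {x : GromovSeq X}
    {H : Subgroup G} [H.Normal]
    (hH : ∀ g : G, g ∈ H ↔ g • GromovBoundary.mk x = GromovBoundary.mk x) {t : G} (ht : t ∉ H)
    (w : X) : ∃ M : ℝ, ∀ h ∈ H,
      ∀ᶠ n in atTop, gromovProduct (h • w) (x.1 n) (t⁻¹ • x.1 n) ≤ M := by
  obtain ⟨δ, -, hδ⟩ := IsHyperbolicSpace.hyperbolic (X := X)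
  have ht' : ¬ GromovClose x.1 (fun n => t⁻¹ • x.1 n) := fun h => ht (inv_mem_iff.1 ((hH t⁻¹).2
    (GromovBoundary.mk_eq_mk (x := x) (y := GromovSeq.translate t⁻¹ x).2 h).symm))
  obtain ⟨M, hM⟩ := exists_eventually_gromovProduct_le hδ ht' w
  refine ⟨M, fun h hh => ?_⟩
  have hclose : ∀ g ∈ H, GromovClose x.1 fun n => g • x.1 n := fun g hg =>
    (GromovBoundary.mk_eq_mk (x := x) (y := GromovSeq.translate g x)).1 ((hH g).1 hg).symm
  -- By normality `t h⁻¹ t⁻¹` lies in `H`, so `h⁻¹` also fixes the end of `t⁻¹ • x`.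
  have h1 : GromovClose (fun n => t⁻¹ • x.1 n) fun n => h⁻¹ • t⁻¹ • x.1 n := by
    have h2 := (hclose (t * h⁻¹ * t⁻¹)
      (Subgroup.Normal.conj_mem inferInstance _ (H.inv_mem hh) t)).smul t⁻¹
    simpa only [mul_smul, inv_smul_smul] using h2
  filter_upwards [hM _ _ (hclose h⁻¹ (H.inv_mem hh)) h1] with n hn
  rwa [gromovProduct_smul]

theorem mainTheorem7 {G X : Type*} [Group G] [MetricSpace X] [IsHyperbolicSpace X]
    [MulAction G X] [IsIsometricSMul G X] (hG : IsTypeThreeMinus G X)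
    (ζ : GromovBoundary X) (hζ : ζ ∈ limitSet G X) :
    ∃ hidx : (orientationPreserving G X).index = 2,
      -- the Busemann quasi-morphism of the orientation preserving subgroup at the limit point
      IsHomogeneousQuasimorphism (busemann (orientationPreserving G X) ζ) ∧
      (∀ x : GromovSeq X, GromovBoundary.mk x = ζ →
        ∃ C : ℝ, ∀ g : orientationPreserving G X,
          |horoQuasimorphism (orientationPreserving G X) x.1 g -
            busemann (orientationPreserving G X) ζ g| ≤ C) ∧
      IsAntisymmetricIn (orientationPreserving G X) hidx
        (busemann (orientationPreserving G X) ζ) ∧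
      -- the reduction to the dihedral quasi-action
      (∀ (t : G) (ht : t ∉ orientationPreserving G X),
        IsQuasiAction (dihedralQuasiAction (orientationPreserving G X) hidx
          (busemann (orientationPreserving G X) ζ) t ht) ∧
        ∃ F : ℝ → X,
          IsReductionMap (fun (g : G) (x : X) => g • x)
            (dihedralQuasiAction (orientationPreserving G X) hidx
              (busemann (orientationPreserving G X) ζ) t ht) F ∧
          (IsCoboundedAction (fun (g : G) (x : X) => g • x) →
            IsEquivalenceMap (fun (g : G) (x : X) => g • x)
              (dihedralQuasiAction (orientationPreserving G X) hidx
                (busemann (orientationPreserving G X) ζ) t ht) F)) ∧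
      (IsCoboundedAction (fun (g : G) (x : X) => g • x) ↔ IsQuasiLine X) := by
  have hidx := hG.index_orientationPreserving hζ
  obtain ⟨ξ, hξ, -, ⟨t₀, ht₀⟩, hiff⟩ := hG.exists_swap hζ
  have ht₀' : t₀ ∉ orientationPreserving G X := fun h =>
    hξ (MulAction.injective t₀ (ht₀.trans ((hiff t₀).1 h).symm))
  have hN : (orientationPreserving G X).Normal := Subgroup.normal_of_index_eq_two hidx
  set H := orientationPreserving G X
  obtain ⟨δ, hδ0, hδ⟩ := IsHyperbolicSpace.hyperbolic (X := X)
  set x : GromovSeq X := Quotient.out ζ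
  have hx : GromovBoundary.mk x = ζ := Quotient.out_eq ζ
  have hiff' : ∀ g : G, g ∈ H ↔ g • GromovBoundary.mk x = GromovBoundary.mk x := by
    rw [hx]
    exact hiff
  have hf : ∀ g h : H, |horoQuasimorphism H x.1 (g * h) - horoQuasimorphism H x.1 g -
      horoQuasimorphism H x.1 h| ≤ 6 * δ := fun g h =>
    abs_quasiHorofunction_mul_sub_le hδ x.2 (g : G) (h : G)
      ((GromovBoundary.mk_eq_mk (x := x) (y := GromovSeq.translate (g : G)⁻¹ x)).1
        ((hiff' _).1 (H.inv_mem g.2)).symm)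
  have hfB : ∀ g : H, |horoQuasimorphism H x.1 g - busemann H ζ g| ≤ 6 * δ :=
    abs_sub_homogenisation_le hf
  have hB : IsHomogeneousQuasimorphism (busemann H ζ) :=
    IsQuasimorphism.homogenisation ⟨6 * δ, by positivity, hf⟩
  have hanti : IsAntisymmetricIn H hidx (busemann H ζ) := by
    intro t ht
    obtain ⟨M, hM⟩ := exists_forall_eventually_gromovProduct_smul_le hiff' ht (x.1 0)
    have hM1 := hM 1 H.one_mem
    rw [one_smul] at hM1
    have hb : ∀ h : H, |busemann H ζ ⟨t * h * t⁻¹, hN.conj_mem h h.2 t⟩ + busemann H ζ h| ≤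
        16 * δ + 2 * M + 2 * dist (x.1 0) (t⁻¹ • x.1 0) := by
      intro h
      have h1 : |horoQuasimorphism H x.1 ⟨t * h * t⁻¹, hN.conj_mem h h.2 t⟩ +
          horoQuasimorphism H x.1 h| ≤ _ :=
        abs_quasiHorofunction_conj_add_le hδ x.2 t h hM1 (hM h h.2)
      have h2 := abs_le.1 (hfB ⟨t * h * t⁻¹, hN.conj_mem h h.2 t⟩)
      have h3 := abs_le.1 (hfB h)
      rw [abs_le] at *
      constructor <;> linarith [h1.1, h1.2, h2.1, h2.2, h3.1, h3.2]
    intro h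
    -- Conjugation commutes with powers, so homogeneity turns the uniform bound into exact
    -- antisymmetry.
    refine eq_neg_of_add_eq_zero_left (eq_zero_of_forall_natCast_mul_le
      (C := 16 * δ + 2 * M + 2 * dist (x.1 0) (t⁻¹ • x.1 0)) fun n => ?_)
    · have h1 := hb (h ^ n)
      have h2 : (⟨t * (h ^ n : H) * t⁻¹, hN.conj_mem _ (h ^ n).2 t⟩ : H) =
          ⟨t * h * t⁻¹, hN.conj_mem h h.2 t⟩ ^ n :=
        Subtype.ext (by simp only [Subgroup.coe_pow, conj_pow])
      have h3 : ∀ g : H, busemann H ζ (g ^ n) = n * busemann H ζ g := fun g => by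
        simpa using hB.2 g n
      rwa [h2, h3, h3, ← mul_add] at h1
  obtain ⟨M, hM⟩ := exists_forall_eventually_gromovProduct_smul_le hiff' ht₀' (x.1 0)
  have hM1 := hM 1 H.one_mem
  rw [one_smul] at hM1
  have hdist : ∀ h : H, |dist (x.1 0) (h • x.1 0) - (|busemann H ζ h|)| ≤ 10 * δ + 2 * M := by
    intro h
    have h1 : |dist (x.1 0) (h • x.1 0) - (|horoQuasimorphism H x.1 h|)| ≤ _ :=
      dist_smul_le_abs_quasiHorofunction hδ x.2 (h : G) hM1 (hM h h.2)
    have h2 := abs_le.1 ((abs_abs_sub_abs_le _ _).trans (hfB h))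
    rw [abs_le] at *
    constructor <;> linarith [h1.1, h1.2, h2.1, h2.2]
  -- If `B` vanished, all displacements by `H` would be at most `10 * δ + 2 * M`.
  obtain ⟨a, ha⟩ : ∃ a : H, busemann H ζ a ≠ 0 := by
    obtain ⟨a, ha⟩ := exists_lt_dist_smul_of_mem_limitSet hζ hidx (x.1 0) (10 * δ + 2 * M)
    refine ⟨a, fun h0 => ?_⟩
    have h1 := hdist a
    rw [h0, abs_zero, sub_zero, abs_of_nonneg dist_nonneg] at h1
    linarith
  obtain ⟨F, horb, hF⟩ := exists_isReductionMap_of_abs_dist_sub_le hidx hB hanti hdist ha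
  refine ⟨hidx, hB, fun y hy => ?_, hanti, fun t ht => ⟨hB.isQuasiAction_dihedral hidx hanti ht,
    F, hF t ht, (hF t ht).isEquivalenceMap⟩, fun h => ?_, fun h =>
    h.isCoboundedAction (hF t₀ ht₀').1 horb⟩
  · refine ⟨10 * δ + 2 * dist (x.1 0) (y.1 0), fun g => ?_⟩
    have h1 : |horoQuasimorphism H x.1 g - horoQuasimorphism H y.1 g| ≤ _ :=
      abs_quasiHorofunction_sub_quasiHorofunction_le hδ y.2
        (GromovBoundary.mk_eq_mk.1 (hx.trans hy.symm)) (g : G)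
    have h2 := hfB g
    rw [abs_le] at *
    constructor <;> linarith [h1.1, h1.2, h2.1, h2.2]
  · exact ⟨IsHyperbolicSpace.geodesic, ((hF t₀ ht₀').isEquivalenceMap h).1.exists_inverse⟩
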